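/- All logarithms are to base $2$. A deletable error pattern of length $n$ is a pair $\mathbf g=(\mathbf e,\mathbf v)\in\{0,1\}^n\times\{D,E,F\}^n$; it acts on a word $\mathbf x\in\{0,1\}^n$ by deleting $x_i$, replacing $x_i$ by an erasure symbol, or replacing $x_i$ by $1-x_i$, for each $i$ with $e_i=1$, according to whether $v_i=D,E,F$; bits with $e_i=0$ are unchanged. Write $F_{\mathbf g}(\mathbf x)$ for the resulting word. The pattern is $Q$-far if $|i-j|\ge Q$ for all $i\ne j$ with $e_i=e_j=1$. A code $\mathcal C\subseteq\{0,1\}^n$ corrects a set $\mathcal F$ of patterns if $F_{\mathbf g_1}(\mathbf x_1)\neq F_{\mathbf g_2}(\mathbf x_2)$ for all distinct $\mathbf x_1,\mathbf x_2\in\mathcal C$ and all $\mathbf g_1,\mathbf g_2\in\mathcal F$; its redundancy is $R(\mathcal C)=n-\log\#\mathcal C$. Let $VT_a(m)=\{\mathbf x\in\{0,1\}^m:\sum_{i=1}^m i\,x_i\equiv a \pmod{2m+1}\}$ and $\delta(P)=\frac{2P+1}{2^{P-1}}$. (1) Let $n\ge P\ge 2$ be integers and $n=tP+s$ with $0\le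 s<P$. There are integers $0\le a_1\le 2P$ and $0\le a_2\le 2(P+s)$ such that the code $\mathcal C_{far}$ of all words $(\mathbf x(1),\dots,\mathbf x(t))$ with $\mathbf x(i)\in VT_{a_1}(P)\setminus\{\mathbf 0,\mathbf 1\}$ for $1\le i\le t-1$ and $\mathbf x(t)\in VT_{a_2}(P+s)$ is non-empty and corrects all $3P$-far deletable error patterns of length $n$, and such that, if $\delta(P)<1$ (that is, $P\ge5$), $$R(\mathcal C_{far})\le\left(\frac nP-1\right)\log\left(\frac{2P+1}{1-\delta(P)}\right)+\log P+2 .$$ (2) For every integer $P\ge2$ there is $N$ such that for all $n\ge N$ every code $\mathcal A\subseteq\{0,1\}^n$ that corrects all $3P$-far deletable error patterns satisfies $R(\mathcal A)\ge\frac{n}{64(3P+6)}-3$. (3) Let $(P_n)$ be a sequence of non-negative integers with $P_n/\log n\to\infty$ and $P_n/\sqrt{n\log n}\to0$ as $n\to\infty$. Then there is $N$ such that for all $n\ge N$ every code $\mathcal B\subseteq\{0,1\}^n$ that corrects all $3P_n$-far deletable error patterns satisfies $$R(\mathcal B)\ge\left(\frac{n}{6P_n}-1\right)\log\left(\frac{3P_n}{64}\right)-2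 .$$ -/

import Mathlib

open Filter Topology

/-- The three kinds of a deletable error: deletion `D`, erasure `E`, substitution `F`. -/
inductive ErrorKind where
  | D
  | E
  | F

/-- Words of length `n`. The `i`-th bit (counted from one) is `x i` with `i` counted from zero. -/
abbrev Word (n : ℕ) : Type := Fin n → Bool

/-- Deletable error patterns of length `n`: positions marked by `1` are hit by an error
of the kind given by the second component. -/
abbrev ErrorPattern (n : ℕ) : Type := (Fin n → Bool) × (Fin n → ErrorKind)

/-- What becomes of a single bit `b` at a place with mark `e` and kind `s`; the erasure symbol is
`none`, and a deleted bit leaves nothing behind. -/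
def corruptBit (e : Bool) (s : ErrorKind) (b : Bool) : List (Option Bool) :=
  if e then
    match s with
    | ErrorKind.D => []
    | ErrorKind.E => [none]
    | ErrorKind.F => [some (!b)]
  else [some b]

/-- The word received when `x` is corrupted by the pattern `g`. -/
def corrupt {n : ℕ} (g : ErrorPattern n) (x : Word n) : List (Option Bool) :=
  (List.finRange n).flatMap fun i => corruptBit (g.1 i) (g.2 i) (x i)

/-- The `Q`-far deletable error patterns of length `n`: any two errors are at least `Q` apart. -/
def farPatterns (n Q : ℕ) : Set (ErrorPattern n) :=
  {g | ∀ i j : Fin n, i ≠ j → g.1 i = true → g.1 j = true → (Q : ℤ) ≤ |(i : ℤ) - (j : ℤ)|}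

/-- The code `C` is capable of correcting all error patterns in `S`. -/
def Corrects {n : ℕ} (C : Finset (Word n)) (S : Set (ErrorPattern n)) : Prop :=
  ∀ x₁ ∈ C, ∀ x₂ ∈ C, x₁ ≠ x₂ → ∀ g₁ ∈ S, ∀ g₂ ∈ S, corrupt g₁ x₁ ≠ corrupt g₂ x₂

/-- The redundancy `n - log₂ #C` of a code of length `n`. -/
noncomputable def redundancy {n : ℕ} (C : Finset (Word n)) : ℝ :=
  (n : ℝ) - Real.logb 2 (C.card : ℝ)

/-- The modified Varshamov-Tenengolts code: all words of length `m` with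
`∑ i * x_i ≡ a (mod 2 m + 1)`, the positions being counted from one. -/
def vtCode (a m : ℕ) : Finset (Word m) :=
  Finset.univ.filter fun x => (∑ i : Fin m, ((i : ℕ) + 1) * (x i).toNat) ≡ a [MOD 2 * m + 1]

/-- The `m` consecutive bits of `x` that follow the first `k` bits
(used only when `k + m ≤ n`, so that the default value `false` never occurs). -/
def subword {n : ℕ} (x : Word n) (k m : ℕ) : Word m :=
  fun j => if h : k + (j : ℕ) < n then x ⟨k + (j : ℕ), h⟩ else false

open Classical in
/-- The concatenated code of length `n = t P + s`, `0 ≤ s < P`: the first `t - 1` blocks have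
length `P`, lie in `vtCode a₁ P` and are not constant; the last block has length `P + s` and lies
in `vtCode a₂ (P + s)`. -/
noncomputable def farCode (n P a₁ a₂ : ℕ) : Finset (Word n) :=
  Finset.univ.filter fun x =>
    (∀ i < n / P - 1, subword x (i * P) P ∈ vtCode a₁ P ∧
      subword x (i * P) P ≠ (fun _ => false) ∧ subword x (i * P) P ≠ (fun _ => true)) ∧
    subword x ((n / P - 1) * P) (P + n % P) ∈ vtCode a₂ (P + n % P)

/-- `δ(P) = (2 P + 1) / 2 ^ (P - 1)`, for `P ≥ 1`. -/
noncomputable def delta (P : ℕ) : ℝ := (2 * (P : ℝ) + 1) / 2 ^ (P - 1)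

/-! The lower bounds (2) and (3) are a packing argument that uses substitutions only. Cut the word
into intervals of length `2 * Q` and flip at most one bit in the first half of each: this gives `(Q
+ 1) ^ T` distinct `Q`-far patterns, and a correcting code must send all pairs (codeword, pattern)
to distinct words (`card_mul_pow_le_of_corrects`). The rest is estimation of logarithms.

For (1), the checksum modulo `2 * m + 1` makes a single block correct one deletion, erasure or
substitution (`eq_of_hit`). Errors `3 * P` apart hit each block at most once, so the only danger is
loss of synchronisation: a block suffers a deletion under one pattern and not under the other, and
the two readings then run one place apart. If the second pattern hits the same block, both patterns
are clean for the next two blocks. Two clean nonconstant blocks cannot be read one place apart: each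
would arise from the other by moving one bit, so the checksum makes them equal, and a word equal to
its own shift is constant (`eq_replicate_of_shift`). Hence the second pattern spares the first block
and, unless the final block comes next, must delete a bit in the following one, which restores
synchronisation (`IsBlockWord.eq_of_delHit`). Induction on the number of blocks finishes the
decoding.

The size of the code comes from the pigeonhole principle over the `2 * m + 1` checksums, used
separately for the nonconstant words of length `P` and for the last block. -/

/-! ### Lower bounds on redundancy: packing with substitutions. -/

/-- A choice of at most one position in the first half of each of `T` consecutive intervals of
length `2 * Q`, as an indicator function; the value `Q` means that no position is chosen. -/
def spreadPositions {T Q : ℕ} (n : ℕ) (c : Fin T → Fin (Q + 1)) (i : Fin n) : Bool :=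
  decide (∃ b : Fin T, (c b : ℕ) < Q ∧ (i : ℕ) = 2 * Q * b + c b)

/-- The unused second half of each interval separates choices made in different intervals. -/
theorem spreadPositions_mem_farPatterns {T Q n : ℕ} (c : Fin T → Fin (Q + 1)) (v : Fin n → ErrorKind) :
    (spreadPositions n c, v) ∈ farPatterns n Q := by
  intro i j hij hi hj
  simp only [spreadPositions, decide_eq_true_eq] at hi hj
  obtain ⟨b, hb, hi⟩ := hi
  obtain ⟨b', hb', hj⟩ := hj
  have hne : (b : ℕ) ≠ b' := by
    intro h
    have h : b = b' := Fin.ext h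
    subst h
    exact hij (Fin.ext (hi.trans hj.symm))
  rw [le_abs]
  rcases lt_or_gt_of_ne hne with h | h
  · right
    have := Nat.mul_le_mul_left (2 * Q) (Nat.succ_le_of_lt h)
    rw [Nat.mul_succ] at this
    omega
  · left
    have := Nat.mul_le_mul_left (2 * Q) (Nat.succ_le_of_lt h)
    rw [Nat.mul_succ] at this
    omega

theorem spreadPositions_injective {T Q n : ℕ} (hT : T * (2 * Q) ≤ n) :
    Function.Injective (spreadPositions (T := T) (Q := Q) n) := by
  have key : ∀ c c' : Fin T → Fin (Q + 1), spreadPositions n c = spreadPositions n c' →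
      ∀ b, (c b : ℕ) < Q → c b = c' b := by
    intro c c' h b hb
    have hlt : 2 * Q * b + c b < n := by
      have := Nat.mul_le_mul_left (2 * Q) (Nat.succ_le_of_lt b.2)
      rw [Nat.mul_succ, mul_comm (2 * Q) T] at this
      omega
    have h1 : spreadPositions n c ⟨2 * Q * b + c b, hlt⟩ = true := by
      simp only [spreadPositions, decide_eq_true_eq]
      exact ⟨b, hb, rfl⟩
    rw [h] at h1
    simp only [spreadPositions, decide_eq_true_eq] at h1
    obtain ⟨b', hb', he⟩ := h1
    have hbb : (b : ℕ) = b' := by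
      by_contra hne
      rcases lt_or_gt_of_ne hne with h | h
      · have := Nat.mul_le_mul_left (2 * Q) (Nat.succ_le_of_lt h)
        rw [Nat.mul_succ] at this
        omega
      · have := Nat.mul_le_mul_left (2 * Q) (Nat.succ_le_of_lt h)
        rw [Nat.mul_succ] at this
        omega
    have hbb' : b = b' := Fin.ext hbb
    subst hbb'
    exact Fin.ext (by omega)
  intro c c' h
  funext b
  by_cases h1 : (c b : ℕ) < Q
  · exact key c c' h b h1
  by_cases h2 : (c' b : ℕ) < Q
  · exact (key c' c h.symm b h2).symm
  -- Neither side chooses a position, so both values are `Q`.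
  · exact Fin.ext (by omega)

theorem corrupt_substitution {n : ℕ} (e : Fin n → Bool) (x : Word n) :
    corrupt (e, fun _ => ErrorKind.F) x = (List.finRange n).map fun i => some (xor (e i) (x i)) := by
  rw [corrupt, ← List.flatMap_pure_eq_map]
  congr 1
  funext i
  cases h : e i <;> simp [corruptBit, h]

/-- Flipping is addition of the pattern to the word: for one codeword the outputs determine the
pattern, and for different codewords they differ because the code corrects. -/
theorem card_mul_pow_le_of_corrects {n Q T : ℕ} (hT : T * (2 * Q) ≤ n) {A : Finset (Word n)}
    (hA : Corrects A (farPatterns n Q)) : A.card * (Q + 1) ^ T ≤ 2 ^ n := by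
  have h1 : (A ×ˢ (Finset.univ : Finset (Fin T → Fin (Q + 1)))).card = A.card * (Q + 1) ^ T := by
    simp [Finset.card_product]
  have h2 : (Finset.univ : Finset (Word n)).card = 2 ^ n := by simp [Word]
  rw [← h1, ← h2]
  refine Finset.card_le_card_of_injOn (fun z i => xor (spreadPositions n z.2 i) (z.1 i))
    (fun _ _ => Finset.mem_coe.2 (Finset.mem_univ _)) ?_
  rintro ⟨x, c⟩ hx ⟨x', c'⟩ hx' h
  simp only [Finset.coe_product, Set.mem_prod, Finset.mem_coe] at hx hx'
  simp only at h
  by_cases hxx : x = x'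
  · subst hxx
    have : spreadPositions n c = spreadPositions n c' := by
      funext i
      have := congrFun h i
      simpa using this
    rw [spreadPositions_injective hT this]
  · refine absurd ?_ (hA x hx.1 x' hx'.1 hxx _
      (spreadPositions_mem_farPatterns c fun _ => ErrorKind.F) _
      (spreadPositions_mem_farPatterns c' fun _ => ErrorKind.F))
    rw [corrupt_substitution, corrupt_substitution]
    refine List.map_congr_left fun i _ => ?_
    exact congrArg some (congrFun h i)

theorem mul_logb_le_redundancy {n Q : ℕ} {A : Finset (Word n)} (hne : A.Nonempty)
    (hA : Corrects A (farPatterns n Q)) :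
    ((n / (2 * Q) : ℕ) : ℝ) * Real.logb 2 (Q + 1) ≤ redundancy A := by
  have h := card_mul_pow_le_of_corrects (Nat.div_mul_le_self n (2 * Q)) hA
  have h' : (A.card : ℝ) * ((Q : ℝ) + 1) ^ (n / (2 * Q)) ≤ 2 ^ n := by exact_mod_cast h
  have hc : (0 : ℝ) < A.card := by exact_mod_cast hne.card_pos
  have hl := Real.logb_le_logb_of_le one_lt_two (by positivity) h'
  rw [Real.logb_mul (by positivity) (by positivity), Real.logb_pow, Real.logb_pow,
    Real.logb_self_eq_one one_lt_two] at hl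
  rw [redundancy]
  linarith

theorem redundancy_nonneg {n : ℕ} (A : Finset (Word n)) : 0 ≤ redundancy A := by
  rw [redundancy]
  rcases A.eq_empty_or_nonempty with rfl | hne
  · simp
  have hc : (0 : ℝ) < A.card := by exact_mod_cast hne.card_pos
  have h : (A.card : ℝ) ≤ 2 ^ n := by
    have := A.card_le_univ
    simp only [Word, Fintype.card_pi, Fintype.card_bool, Finset.prod_const, Finset.card_univ,
      Fintype.card_fin] at this
    exact_mod_cast this
  have hl := Real.logb_le_logb_of_le one_lt_two hc h
  rw [Real.logb_pow, Real.logb_self_eq_one one_lt_two] at hl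
  linarith

theorem redundancy_lower_bound {n Q : ℕ} (hQ : 0 < Q) {A : Finset (Word n)} (hne : A.Nonempty)
    (hA : Corrects A (farPatterns n Q)) :
    ((n : ℝ) / (2 * Q) - 1) * Real.logb 2 (Q + 1) ≤ redundancy A := by
  refine le_trans ?_ (mul_logb_le_redundancy hne hA)
  have hQ' : (0 : ℝ) < Q := by exact_mod_cast hQ
  refine mul_le_mul_of_nonneg_right ?_ (Real.logb_nonneg one_lt_two (by linarith))
  have := (Nat.lt_floor_add_one ((n : ℝ) / (2 * Q : ℕ))).le
  rw [Nat.floor_div_natCast, Nat.floor_natCast] at this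
  push_cast at this
  linarith

theorem logb_two_le_self {x : ℝ} (hx : 0 ≤ x) : Real.logb 2 x ≤ x := by
  rcases hx.eq_or_lt with rfl | h
  · simp
  rw [Real.logb_le_iff_le_rpow one_lt_two h]
  rcases le_total x 1 with h1 | h1
  · exact h1.trans (Real.one_le_rpow one_le_two hx)
  -- Bernoulli's inequality `1 + x ≤ 2 ^ x`.
  have := one_add_mul_self_le_rpow_one_add (s := 1) (by norm_num) (p := x) h1
  rw [one_add_one_eq_two] at this
  linarith

theorem redundancy_lower_bound_const (P : ℕ) (hP : 2 ≤ P) : ∃ N : ℕ, ∀ n ≥ N,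
    ∀ A : Finset (Word n), Corrects A (farPatterns n (3 * P)) →
      (n : ℝ) / (64 * (3 * P + 6)) - 3 ≤ redundancy A := by
  -- Chosen so that `n / (6 * P) ≥ 3 * P + 1 ≥ L` with `L = log (3 * P + 1) ≥ 2`; then `(n / (6 * P)
  -- - 1) * L ≥ n / (6 * P)`.
  refine ⟨6 * P * (3 * P + 1), fun n hn A hA => ?_⟩
  have hP' : (2 : ℝ) ≤ P := by exact_mod_cast hP
  have hn' : 6 * (P : ℝ) * (3 * P + 1) ≤ n := by exact_mod_cast hn
  have hn0 : (0 : ℝ) ≤ n := n.cast_nonneg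
  -- For the empty code `logb 2 0 = 0`, so its redundancy is `n` and has to be compared directly.
  rcases A.eq_empty_or_nonempty with rfl | hne
  · have : (n : ℝ) / (64 * (3 * P + 6)) ≤ n := div_le_self hn0 (by linarith)
    simp only [redundancy, Finset.card_empty, Nat.cast_zero, Real.logb_zero, sub_zero]
    linarith
  have h := redundancy_lower_bound (by omega) hne hA
  push_cast at h
  have hL : Real.logb 2 (3 * P + 1) ≤ 3 * P + 1 := logb_two_le_self (by linarith)
  have hL2 : 2 ≤ Real.logb 2 (3 * P + 1) := by
    rw [Real.le_logb_iff_rpow_le one_lt_two (by linarith)]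
    norm_num
    linarith
  have h1 : (n : ℝ) / (64 * (3 * P + 6)) ≤ n / (2 * (3 * P)) :=
    div_le_div_of_nonneg_left hn0 (by linarith) (by linarith)
  have h2 : 3 * (P : ℝ) + 1 ≤ n / (2 * (3 * P)) := by
    rw [le_div_iff₀ (by linarith)]
    linarith
  nlinarith

/-- 22 is the least `P` with `3 * P / 64 ≥ 1`, which makes the logarithm nonnegative. -/
theorem redundancy_lower_bound_of_le {n P : ℕ} (hP : 22 ≤ P) {B : Finset (Word n)}
    (hB : Corrects B (farPatterns n (3 * P))) :
    ((n : ℝ) / (6 * P) - 1) * Real.logb 2 (3 * P / 64) - 2 ≤ redundancy B := by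
  have hP' : (22 : ℝ) ≤ P := by exact_mod_cast hP
  have hn0 : (0 : ℝ) ≤ n := n.cast_nonneg
  have hlog : 0 ≤ Real.logb 2 (3 * P / 64) := Real.logb_nonneg one_lt_two (by linarith)
  rcases le_total ((n : ℝ) / (6 * P) - 1) 0 with hneg | hpos
  · have := redundancy_nonneg B
    nlinarith
  rcases B.eq_empty_or_nonempty with rfl | hne
  · have hl : Real.logb 2 (3 * P / 64) ≤ 3 * P / 64 := logb_two_le_self (by linarith)
    simp only [redundancy, Finset.card_empty, Nat.cast_zero, Real.logb_zero, sub_zero]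
    have h1 := mul_le_mul_of_nonneg_left hl hpos
    have h2 : (n : ℝ) / (6 * P) * (3 * P / 64) = n / 128 := by
      field_simp
      ring
    nlinarith
  have h := redundancy_lower_bound (by omega) hne hB
  push_cast at h
  rw [show 2 * (3 * (P : ℝ)) = 6 * P by ring] at h
  have hmono : Real.logb 2 (3 * P / 64) ≤ Real.logb 2 (3 * P + 1) :=
    Real.logb_le_logb_of_le one_lt_two (by linarith) (by linarith)
  have := mul_le_mul_of_nonneg_left hmono hpos
  linarith

theorem redundancy_lower_bound_growing (P : ℕ → ℕ)
    (hP : Tendsto (fun n : ℕ => (P n : ℝ) / Real.logb 2 n) atTop atTop) :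
    ∃ N : ℕ, ∀ n ≥ N, ∀ B : Finset (Word n), Corrects B (farPatterns n (3 * P n)) →
      ((n : ℝ) / (6 * P n) - 1) * Real.logb 2 (3 * P n / 64) - 2 ≤ redundancy B := by
  obtain ⟨N, hN⟩ := eventually_atTop.1 (hP.eventually_ge_atTop 22)
  refine ⟨max N 2, fun n hn B hB => redundancy_lower_bound_of_le ?_ hB⟩
  have h := hN n (le_trans (le_max_left _ _) hn)
  have hn2 : (2 : ℝ) ≤ n := by exact_mod_cast le_trans (le_max_right _ _) hn
  have hl : 1 ≤ Real.logb 2 n := by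
    rw [Real.le_logb_iff_rpow_le one_lt_two (by linarith)]
    simpa using hn2
  rw [le_div_iff₀ (by linarith)] at h
  have : (22 : ℝ) ≤ P n := by linarith
  exact_mod_cast this

/-! ### Single-error correction in one block. -/

/-- `∑ (k + i) * w i` for a list `w` of bits, the positions being counted from zero. -/
def vtSum : ℕ → List Bool → ℕ
  | _, [] => 0
  | k, b :: w => k * b.toNat + vtSum (k + 1) w

theorem vtSum_append (k : ℕ) (u v : List Bool) :
    vtSum k (u ++ v) = vtSum k u + vtSum (k + u.length) v := by
  induction u generalizing k with
  | nil => simp [vtSum]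
  | cons b u ih => simp [vtSum, ih, add_assoc, add_comm 1]

theorem vtSum_succ (k : ℕ) (w : List Bool) : vtSum (k + 1) w = vtSum k w + w.count true := by
  induction w generalizing k with
  | nil => simp [vtSum]
  | cons b w ih => cases b <;> simp [vtSum, ih] <;> ring

/-- This is where the modulus `2 * M + 1` matters: two substitutions can change the checksum by up
to `2 * M` in absolute value. -/
theorem int_eq_zero_of_dvd {M : ℕ} {d : ℤ} (h : ((2 * M + 1 : ℕ) : ℤ) ∣ d) (h1 : -(2 * M : ℤ) ≤ d)
    (h2 : d ≤ 2 * M) : d = 0 := by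
  refine Int.eq_zero_of_abs_lt_dvd h ?_
  rw [abs_lt]
  push_cast
  constructor <;> linarith

/-- Passing the bit over `m` shifts the ones of `m` by one place. The checksums then force `b = c`
and every bit of `m` to equal `b`; for `b ≠ c` the difference is never zero. -/
theorem cons_eq_append_singleton_of_vtSum {M : ℕ} {u m v : List Bool} {b c : Bool}
    (hM : (u ++ b :: (m ++ v)).length = M)
    (h : vtSum 1 (u ++ b :: (m ++ v)) ≡ vtSum 1 (u ++ (m ++ c :: v)) [MOD 2 * M + 1]) :
    b :: m = m ++ [c] := by
  have hd := h.symm.dvd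
  have hcount := List.count_le_length (a := true) (l := m)
  have e1 : ((vtSum 1 (u ++ b :: (m ++ v)) : ℕ) : ℤ) - (vtSum 1 (u ++ (m ++ c :: v)) : ℕ) =
      (1 + u.length) * (b.toNat : ℤ) + m.count true - (1 + u.length + m.length) * (c.toNat : ℤ) := by
    simp only [vtSum_append, vtSum, vtSum_succ (1 + u.length) m]
    rw [show 1 + u.length + 1 + m.length = 1 + u.length + m.length + 1 by ring]
    push_cast
    ring
  rw [e1] at hd
  simp only [List.length_append, List.length_cons] at hM
  cases b <;> cases c <;> simp only [Bool.toNat_false, Bool.toNat_true, Nat.cast_zero, Nat.cast_one,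
    mul_zero, mul_one] at hd <;> have hz := int_eq_zero_of_dvd hd (by omega) (by omega)
  · have : m = List.replicate m.length false := by
      rw [List.eq_replicate_iff]
      refine ⟨rfl, fun x hx => ?_⟩
      have h0 : m.count true = 0 := by omega
      rw [List.count_eq_zero] at h0
      cases x
      · rfl
      · exact absurd hx h0
    rw [this, ← List.replicate_succ, ← List.replicate_succ']
  · omega
  · omega
  · have : m = List.replicate m.length true := by
      rw [List.eq_replicate_iff]
      refine ⟨rfl, fun x hx => ?_⟩
      have h0 : m.count true = m.length := by omega
      rw [List.count_eq_length] at h0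
      exact (h0 x hx).symm
    rw [this, ← List.replicate_succ, ← List.replicate_succ']

theorem eq_of_vtSum_of_length_le {M : ℕ} {u v u' v' : List Bool} {b c : Bool}
    (hM : (u ++ b :: v).length = M) (hle : u.length ≤ u'.length) (he : u ++ v = u' ++ v')
    (h : vtSum 1 (u ++ b :: v) ≡ vtSum 1 (u' ++ c :: v') [MOD 2 * M + 1]) :
    u ++ b :: v = u' ++ c :: v' := by
  obtain ⟨m, rfl⟩ : ∃ m, u' = u ++ m :=
    (List.prefix_of_prefix_length_le (List.prefix_append u v)
      (he ▸ List.prefix_append u' v') hle).imp fun _ h => h.symm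
  rw [List.append_assoc, List.append_cancel_left_eq] at he
  subst he
  rw [List.append_assoc] at h
  have := cons_eq_append_singleton_of_vtSum hM h
  rw [← List.cons_append, this]
  simp

/-- The code defined by `vtSum` corrects a single deletion. -/
theorem eq_of_vtSum_of_deletion {M : ℕ} {u v u' v' : List Bool} {b c : Bool}
    (hM : (u ++ b :: v).length = M) (he : u ++ v = u' ++ v')
    (h : vtSum 1 (u ++ b :: v) ≡ vtSum 1 (u' ++ c :: v') [MOD 2 * M + 1]) :
    u ++ b :: v = u' ++ c :: v' := by
  rcases le_total u.length u'.length with hle | hle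
  · exact eq_of_vtSum_of_length_le hM hle he h
  · refine (eq_of_vtSum_of_length_le ?_ hle he.symm h.symm).symm
    have := congrArg List.length he
    simp only [List.length_append, List.length_cons] at this hM ⊢
    omega

/-- The possible results `y` of at most one error in the word `w`: no error, a deletion, or an
erasure or a substitution. -/
def Unhit (w : List Bool) (y : List (Option Bool)) : Prop := y = w.map some

def DelHit (w : List Bool) (y : List (Option Bool)) : Prop :=
  ∃ u b v, w = u ++ b :: v ∧ y = (u ++ v).map some

def SymHit (w : List Bool) (y : List (Option Bool)) : Prop :=
  ∃ u b v, w = u ++ b :: v ∧ (y = (u ++ (!b) :: v).map some ∨ y = u.map some ++ none :: v.map some)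

theorem Unhit.length {w y} (h : Unhit w y) : y.length = w.length := by
  rw [h, List.length_map]

theorem DelHit.length {w y} (h : DelHit w y) : y.length + 1 = w.length := by
  obtain ⟨u, b, v, rfl, rfl⟩ := h
  simp
  omega

theorem SymHit.length {w y} (h : SymHit w y) : y.length = w.length := by
  obtain ⟨u, b, v, rfl, rfl | rfl⟩ := h <;> simp

theorem vtSum_flip (k : ℕ) (u v : List Bool) (b : Bool) :
    (vtSum k (u ++ (!b) :: v) : ℤ) =
      vtSum k (u ++ b :: v) + (k + u.length) * (1 - 2 * (b.toNat : ℤ)) := by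
  simp only [vtSum_append, vtSum]
  cases b <;> simp <;> ring

theorem Unhit.eq_of_unhit {w w' y} (h : Unhit w y) (h' : Unhit w' y) : w = w' :=
  List.map_injective_iff.2 (Option.some_injective _) (h.symm.trans h')

theorem DelHit.eq_of_delHit {w w' y} (h : DelHit w y) (h' : DelHit w' y)
    (hvt : vtSum 1 w ≡ vtSum 1 w' [MOD 2 * w.length + 1]) : w = w' := by
  obtain ⟨u, b, v, rfl, rfl⟩ := h
  obtain ⟨u', b', v', rfl, h'⟩ := h'
  exact eq_of_vtSum_of_deletion rfl (List.map_injective_iff.2 (Option.some_injective _) h') hvt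

theorem SymHit.eq_of_unhit {w w' y} (h : SymHit w y) (h' : Unhit w' y)
    (hvt : vtSum 1 w ≡ vtSum 1 w' [MOD 2 * w.length + 1]) : w = w' := by
  have hlen := h.length.symm.trans h'.length
  obtain ⟨u, b, v, rfl, rfl | rfl⟩ := h
  · have : u ++ (!b) :: v = w' := List.map_injective_iff.2 (Option.some_injective _) h'
    subst this
    have hd := hvt.dvd
    rw [vtSum_flip, add_sub_cancel_left] at hd
    simp only [List.length_append, List.length_cons] at hd
    exfalso
    cases b
    · have := int_eq_zero_of_dvd hd (by simp; omega) (by simp; omega)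
      simp at this
      omega
    · have := int_eq_zero_of_dvd hd (by simp; omega) (by simp; omega)
      simp at this
      omega
  · have : none ∈ w'.map some := by
      rw [← show _ = w'.map some from h']
      simp
    simp at this

/-- Two substitutions at places `i` and `j` change the checksum by `±i` and `±j`, so equal checksums
force `i = j`. Two erasures show their common place and reduce to a deletion there; the erasure
symbol rules out the mixed case. -/
theorem SymHit.eq_of_symHit {w w' y} (h : SymHit w y) (h' : SymHit w' y)
    (hvt : vtSum 1 w ≡ vtSum 1 w' [MOD 2 * w.length + 1]) : w = w' := by
  have hlen := h.length.symm.trans h'.length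
  obtain ⟨u, b, v, rfl, rfl | rfl⟩ := h <;> obtain ⟨u', b', v', rfl, h' | h'⟩ := h'
  · have he : u ++ (!b) :: v = u' ++ (!b') :: v' :=
      List.map_injective_iff.2 (Option.some_injective _) h'
    have h1 := vtSum_flip 1 u v b
    have h2 := vtSum_flip 1 u' v' b'
    rw [he] at h1
    have hd := hvt.dvd
    have e : (vtSum 1 (u' ++ b' :: v') : ℤ) - vtSum 1 (u ++ b :: v) =
        (1 + u.length) * (1 - 2 * (b.toNat : ℤ)) - (1 + u'.length) * (1 - 2 * (b'.toNat : ℤ)) := by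
      push_cast at h1 h2
      linarith
    rw [e] at hd
    simp only [List.length_append, List.length_cons] at hd hlen
    have hu : u.length = u'.length := by
      cases b <;> cases b' <;> simp only [Bool.toNat_false, Bool.toNat_true, Nat.cast_zero,
        Nat.cast_one] at hd <;> have := int_eq_zero_of_dvd hd (by push_cast; omega)
          (by push_cast; omega) <;> omega
    obtain ⟨rfl, h4⟩ := List.append_inj he hu
    simp only [List.cons.injEq, Bool.not_inj_iff] at h4
    rw [h4.1, h4.2]
  · exfalso
    have : none ∈ (u ++ (!b) :: v).map some := by
      rw [h']
      simp
    simp at this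
  · exfalso
    have : none ∈ (u' ++ (!b') :: v').map some := by
      rw [← h']
      simp
    simp at this
  · have hu : u = u' ∧ v = v' := by
      clear hvt hlen
      induction u generalizing u' with
      | nil =>
        cases u' with
        | nil =>
          simp only [List.map_nil, List.nil_append, List.cons.injEq, true_and] at h'
          exact ⟨rfl, List.map_injective_iff.2 (Option.some_injective _) h'⟩
        | cons a u' => simp at h'
      | cons a u ih =>
        cases u' with
        | nil => simp at h'
        | cons a' u' =>
          simp only [List.map_cons, List.cons_append, List.cons.injEq, Option.some.injEq] at h'
          obtain ⟨rfl, h'⟩ := h'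
          obtain ⟨rfl, rfl⟩ := ih u' h'
          exact ⟨rfl, rfl⟩
    obtain ⟨rfl, rfl⟩ := hu
    refine eq_of_vtSum_of_deletion rfl rfl hvt

/-- The length of `y` tells whether a bit was deleted, so a deletion competes only with a deletion.
-/
theorem eq_of_hit {w w' : List Bool} {y : List (Option Bool)} (hlen : w.length = w'.length)
    (h : Unhit w y ∨ DelHit w y ∨ SymHit w y) (h' : Unhit w' y ∨ DelHit w' y ∨ SymHit w' y)
    (hvt : vtSum 1 w ≡ vtSum 1 w' [MOD 2 * w.length + 1]) : w = w' := by
  have hvt' := hvt.symm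
  rw [hlen] at hvt'
  rcases h with h | h | h <;> rcases h' with h' | h' | h'
  · exact h.eq_of_unhit h'
  · have := h.length; have := h'.length; omega
  · exact (h'.eq_of_unhit h hvt').symm
  · have := h.length; have := h'.length; omega
  · exact h.eq_of_delHit h' hvt
  · have := h.length; have := h'.length; omega
  · exact h.eq_of_unhit h' hvt
  · have := h.length; have := h'.length; omega
  · exact h.eq_of_symHit h' hvt

/-! ### Received segments of a long word. -/

/-- The symbols received in place of the bits `x a, …, x (a + m - 1)` when the errors are given
by `e`. -/
def received (e : ℕ → Option ErrorKind) (x : ℕ → Bool) (a m : ℕ) : List (Option Bool) :=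
  (List.range' a m).flatMap fun i => corruptBit (e i).isSome ((e i).getD ErrorKind.D) (x i)

/-- The bits `x a, …, x (a + m - 1)`. -/
def bits (x : ℕ → Bool) (a m : ℕ) : List Bool := (List.range' a m).map x

theorem bits_length (x : ℕ → Bool) (a m : ℕ) : (bits x a m).length = m := by simp [bits]

theorem bits_add (x : ℕ → Bool) (a m k : ℕ) :
    bits x a (m + k) = bits x a m ++ bits x (a + m) k := by
  simp [bits, ← List.range'_append_1]

theorem bits_succ (x : ℕ → Bool) (a m : ℕ) :
    bits x a (m + 1) = x a :: bits x (a + 1) m := by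
  simp [bits, List.range'_succ]

theorem received_add (e : ℕ → Option ErrorKind) (x : ℕ → Bool) (a m k : ℕ) :
    received e x a (m + k) = received e x a m ++ received e x (a + m) k := by
  simp [received, ← List.range'_append_1]

theorem received_succ (e : ℕ → Option ErrorKind) (x : ℕ → Bool) (a m : ℕ) :
    received e x a (m + 1) =
      corruptBit (e a).isSome ((e a).getD ErrorKind.D) (x a) ++ received e x (a + 1) m := by
  simp [received, List.range'_succ]

theorem unhit_received {e : ℕ → Option ErrorKind} {x : ℕ → Bool} {a m : ℕ}
    (h : ∀ i, a ≤ i → i < a + m → e i = none) : Unhit (bits x a m) (received e x a m) := by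
  rw [Unhit, received, bits, List.map_map, ← List.flatMap_pure_eq_map]
  refine List.flatMap_congr fun i hi => ?_
  rw [List.mem_range'_1] at hi
  simp [h i hi.1 hi.2, corruptBit]

/-- Any two errors of `e` are at least `Q` apart. -/
def Far (e : ℕ → Option ErrorKind) (Q : ℕ) : Prop :=
  ∀ i j, i < j → e i ≠ none → e j ≠ none → i + Q ≤ j

theorem Far.eq_none {e : ℕ → Option ErrorKind} {Q i j : ℕ} (h : Far e Q) (hi : e i ≠ none)
    (hne : i ≠ j) (h1 : j < i + Q) (h2 : i < j + Q) : e j = none := by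
  by_contra hj
  rcases lt_or_gt_of_ne hne with hlt | hlt
  · have := h i j hlt hi hj
    omega
  · have := h j i hlt hj hi
    omega

/-- The place `p` is kept in the conclusion because it guarantees an error-free stretch after it. -/
theorem hit_received {e : ℕ → Option ErrorKind} {Q : ℕ} (he : Far e Q) (x : ℕ → Bool) {a m : ℕ}
    (hm : m ≤ Q) :
    (∀ i, a ≤ i → i < a + m → e i = none) ∨
      ∃ p, a ≤ p ∧ p < a + m ∧ e p ≠ none ∧
        (DelHit (bits x a m) (received e x a m) ∨ SymHit (bits x a m) (received e x a m)) := by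
  by_cases hex : ∃ p, a ≤ p ∧ p < a + m ∧ e p ≠ none
  · right
    obtain ⟨p, h1, h2, hp⟩ := hex
    refine ⟨p, h1, h2, hp, ?_⟩
    obtain ⟨k, rfl⟩ := Nat.exists_eq_add_of_le h1
    obtain ⟨l, rfl⟩ : ∃ l, m = k + (l + 1) := ⟨m - k - 1, by omega⟩
    have hu : received e x a k = (bits x a k).map some :=
      unhit_received fun i hi hi' => he.eq_none hp (by omega) (by omega) (by omega)
    have hv : received e x (a + k + 1) l = (bits x (a + k + 1) l).map some :=
      unhit_received fun i hi hi' => he.eq_none hp (by omega) (by omega) (by omega)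
    rw [bits_add, received_add, bits_succ, received_succ, hu, hv]
    obtain ⟨v, hv⟩ := Option.ne_none_iff_exists'.1 hp
    rw [hv]
    cases v
    · left
      exact ⟨_, _, _, rfl, by simp [corruptBit]⟩
    · right
      exact ⟨_, _, _, rfl, Or.inr (by simp [corruptBit])⟩
    · right
      exact ⟨_, _, _, rfl, Or.inl (by simp [corruptBit])⟩
  · left
    intro i hi hi'
    by_contra hne
    exact hex ⟨i, hi, hi', hne⟩

theorem received_length_le (e : ℕ → Option ErrorKind) (x : ℕ → Bool) (a m : ℕ) :
    (received e x a m).length ≤ m := by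
  induction m generalizing a with
  | zero => simp [received]
  | succ m ih =>
    have : (corruptBit (e a).isSome ((e a).getD ErrorKind.D) (x a)).length ≤ 1 := by
      rcases e a with _ | _ | _ | _ <;> simp [corruptBit]
    have := ih (a + 1)
    rw [received_succ, List.length_append]
    omega

theorem received_length {e : ℕ → Option ErrorKind} {x : ℕ → Bool} {a m : ℕ}
    (h : ∀ i, a ≤ i → i < a + m → e i = none) : (received e x a m).length = m := by
  rw [(unhit_received h).length, bits_length]

theorem append_eq_append_of_length_succ {α : Type*} {y y' r r' : List α}
    (h : y ++ r = y' ++ r') (hl : y.length + 1 = y'.length) :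
    ∃ o, y' = y ++ [o] ∧ r = o :: r' := by
  obtain ⟨m, rfl⟩ : ∃ m, y' = y ++ m :=
    (List.prefix_of_prefix_length_le (List.prefix_append y r)
      (h ▸ List.prefix_append y' r') (by omega)).imp fun _ h => h.symm
  rw [List.append_assoc, List.append_cancel_left_eq] at h
  rw [List.length_append] at hl
  obtain ⟨o, rfl⟩ := List.length_eq_one_iff.1 (show m.length = 1 by omega)
  exact ⟨o, rfl, h⟩

theorem eq_replicate_of_cons_eq_append {α : Type*} {b c : α} {m : List α}
    (h : b :: m = m ++ [c]) : m = List.replicate m.length b := by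
  induction m with
  | nil => rfl
  | cons a m ih =>
    simp only [List.cons_append, List.cons.injEq] at h
    obtain ⟨rfl, h⟩ := h
    rw [List.length_cons, List.replicate_succ, ← ih h]

/-! ### Block-by-block decoding and resynchronisation. -/

/-- Two codewords of the Varshamov-Tenengolts code one of which is received shifted by one place
against the other are constant. -/
theorem eq_replicate_of_shift {w w' : List Bool} {o o' : Option Bool}
    (hvt : vtSum 1 w ≡ vtSum 1 w' [MOD 2 * w.length + 1])
    (hs : o :: w'.map some = w.map some ++ [o']) (hw : w ≠ []) :
    ∃ b, w = List.replicate w.length b := by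
  obtain ⟨b, m, rfl⟩ := List.exists_cons_of_ne_nil hw
  simp only [List.map_cons, List.cons_append, List.cons.injEq] at hs
  obtain ⟨rfl, hs⟩ := hs
  obtain ⟨l₁, l₂, rfl, h1, h2⟩ := List.map_eq_append_iff.1 hs
  obtain ⟨c, rfl⟩ : ∃ c, l₂ = [c] := by
    have := congrArg List.length h2
    simp only [List.length_map, List.length_cons, List.length_nil] at this
    exact List.length_eq_one_iff.1 this
  have : l₁ = m := List.map_injective_iff.2 (Option.some_injective _) h1
  subst this
  have := eq_of_vtSum_of_deletion (u := []) (v := l₁) (u' := l₁) (v' := []) (b := b) (c := c) rfl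
    (by simp) hvt
  refine ⟨b, ?_⟩
  rw [List.nil_append] at this
  rw [List.length_cons, List.replicate_succ, ← eq_replicate_of_cons_eq_append this]

/-- `r` consecutive nonconstant blocks of length `P` starting at place `a`, followed by a block of
length `P + s`, with the checksums `a₁` and `a₂`. -/
structure IsBlockWord (P s a₁ a₂ : ℕ) (x : ℕ → Bool) (a r : ℕ) : Prop where
  vt : ∀ i < r, vtSum 1 (bits x (a + i * P) P) ≡ a₁ [MOD 2 * P + 1]
  nonconst : ∀ i < r, ∀ b, bits x (a + i * P) P ≠ List.replicate P b
  vt_last : vtSum 1 (bits x (a + r * P) (P + s)) ≡ a₂ [MOD 2 * (P + s) + 1]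

theorem IsBlockWord.tail {P s a₁ a₂ : ℕ} {x : ℕ → Bool} {a r : ℕ}
    (h : IsBlockWord P s a₁ a₂ x a (r + 1)) : IsBlockWord P s a₁ a₂ x (a + P) r := by
  have e : ∀ i, a + P + i * P = a + (i + 1) * P := fun i => by ring
  refine ⟨fun i hi => ?_, fun i hi => ?_, ?_⟩
  · rw [e]
    exact h.vt _ (by omega)
  · rw [e]
    exact h.nonconst _ (by omega)
  · rw [e]
    exact h.vt_last

section

variable {P s a₁ a₂ : ℕ} {e₁ e₂ : ℕ → Option ErrorKind} {x₁ x₂ : ℕ → Bool}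

theorem IsBlockWord.head_modEq {a r : ℕ} (h₁ : IsBlockWord P s a₁ a₂ x₁ a (r + 1))
    (h₂ : IsBlockWord P s a₁ a₂ x₂ a (r + 1)) :
    vtSum 1 (bits x₁ a P) ≡ vtSum 1 (bits x₂ a P) [MOD 2 * (bits x₁ a P).length + 1] := by
  have h1 := h₁.vt 0 (by omega)
  have h2 := h₂.vt 0 (by omega)
  rw [zero_mul, add_zero] at h1 h2
  rw [bits_length]
  exact h1.trans h2.symm

theorem IsBlockWord.last_modEq {a : ℕ} (h₁ : IsBlockWord P s a₁ a₂ x₁ a 0)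
    (h₂ : IsBlockWord P s a₁ a₂ x₂ a 0) :
    vtSum 1 (bits x₁ a (P + s)) ≡ vtSum 1 (bits x₂ a (P + s))
      [MOD 2 * (bits x₁ a (P + s)).length + 1] := by
  have h1 := h₁.vt_last
  have h2 := h₂.vt_last
  rw [zero_mul, add_zero] at h1 h2
  rw [bits_length]
  exact h1.trans h2.symm

theorem received_blocks (e : ℕ → Option ErrorKind) (x : ℕ → Bool) (P s a r : ℕ) :
    received e x a ((r + 1) * P + (P + s)) =
      received e x a P ++ received e x (a + P) (r * P + (P + s)) := by
  rw [← received_add]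
  congr 1
  ring

theorem bits_blocks (x : ℕ → Bool) (P s a r : ℕ) :
    bits x a ((r + 1) * P + (P + s)) = bits x a P ++ bits x (a + P) (r * P + (P + s)) := by
  rw [← bits_add]
  congr 1
  ring

/-- A shift by one place is impossible before an intact nonconstant block. -/
theorem IsBlockWord.not_shift (hP : 0 < P) {a r : ℕ} {o : Option Bool}
    (h₁ : IsBlockWord P s a₁ a₂ x₁ a (r + 1)) (h₂ : IsBlockWord P s a₁ a₂ x₂ a (r + 1))
    (hc₁ : ∀ i, a ≤ i → i < a + P → e₁ i = none) (hc₂ : ∀ i, a ≤ i → i < a + P → e₂ i = none)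
    (h : received e₁ x₁ a ((r + 1) * P + (P + s)) =
      o :: received e₂ x₂ a ((r + 1) * P + (P + s))) : False := by
  rw [received_blocks, received_blocks, ← List.cons_append] at h
  obtain ⟨o', ho, -⟩ := append_eq_append_of_length_succ h (by
    rw [List.length_cons, received_length hc₁, received_length hc₂])
  have hu₁ := unhit_received (x := x₁) hc₁
  have hu₂ := unhit_received (x := x₂) hc₂
  rw [Unhit] at hu₁ hu₂
  rw [hu₁, hu₂] at ho
  obtain ⟨b, hb⟩ := eq_replicate_of_shift (h₁.head_modEq h₂) ho (by
    intro h0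
    have := bits_length x₁ a P
    rw [h0, List.length_nil] at this
    omega)
  rw [bits_length] at hb
  refine h₁.nonconst 0 (by omega) b ?_
  rwa [zero_mul, add_zero]

/-- A shift by one place is impossible if the second pattern has no errors in the next `2 * P`
places. -/
theorem IsBlockWord.not_shift' (hP : 0 < P) (hs : s < P) {a r : ℕ} {o : Option Bool}
    (h₁ : IsBlockWord P s a₁ a₂ x₁ a r) (h₂ : IsBlockWord P s a₁ a₂ x₂ a r)
    (hc₁ : ∀ i, a ≤ i → i < a + P → e₁ i = none)
    (hc₂ : ∀ i, a ≤ i → i < a + 2 * P → e₂ i = none)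
    (h : received e₁ x₁ a (r * P + (P + s)) = o :: received e₂ x₂ a (r * P + (P + s))) :
    False := by
  cases r with
  | zero =>
    -- In the last block the lengths conflict: the right side has `P + s + 1` symbols, the left at
    -- most `P + s`. Since `s < P`, the clean `2 * P` places cover this block.
    have hl := congrArg List.length h
    have := received_length_le e₁ x₁ a (0 * P + (P + s))
    rw [List.length_cons, received_length (e := e₂) fun i hi hi' => hc₂ i hi (by omega)] at hl
    omega
  | succ r => exact h₁.not_shift hP h₂ hc₁ (fun i hi hi' => hc₂ i hi (by omega)) h

/-- Decoding a block in which the first pattern has a deletion but the second has not. -/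
theorem IsBlockWord.eq_of_delHit (hP : 0 < P) (hs : s < P) (he₁ : Far e₁ (3 * P))
    (he₂ : Far e₂ (3 * P)) {a r p : ℕ}
    (ih : ∀ r' < r, ∀ a', IsBlockWord P s a₁ a₂ x₁ a' r' → IsBlockWord P s a₁ a₂ x₂ a' r' →
      received e₁ x₁ a' (r' * P + (P + s)) = received e₂ x₂ a' (r' * P + (P + s)) →
      bits x₁ a' (r' * P + (P + s)) = bits x₂ a' (r' * P + (P + s)))
    (h₁ : IsBlockWord P s a₁ a₂ x₁ a (r + 1)) (h₂ : IsBlockWord P s a₁ a₂ x₂ a (r + 1))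
    (h : received e₁ x₁ a ((r + 1) * P + (P + s)) = received e₂ x₂ a ((r + 1) * P + (P + s)))
    (hp : a ≤ p) (hp' : p < a + P) (hpe : e₁ p ≠ none)
    (hd : DelHit (bits x₁ a P) (received e₁ x₁ a P))
    (hl : (received e₂ x₂ a P).length = P) :
    bits x₁ a ((r + 1) * P + (P + s)) = bits x₂ a ((r + 1) * P + (P + s)) := by
  -- The distance `3 * P` leaves the two blocks after the deletion free of errors of `e₁`.
  have hc₁ : ∀ i, a + P ≤ i → i < a + 3 * P → e₁ i = none := fun i hi hi' =>
    he₁.eq_none hpe (by omega) (by omega) (by omega)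
  rw [received_blocks, received_blocks] at h
  have hdl := hd.length
  rw [bits_length] at hdl
  obtain ⟨o, ho, hr⟩ := append_eq_append_of_length_succ h (by omega)
  rcases hit_received he₂ x₂ (a := a) (m := P) (by omega) with hc₂ | ⟨q, hq, hq', hqe, -⟩
  swap
  · exact (h₁.tail.not_shift' hP hs h₂.tail (fun i hi hi' => hc₁ i hi (by omega))
      (fun i hi hi' => he₂.eq_none hqe (by omega) (by omega) (by omega)) hr).elim
  have hu₂ := unhit_received (x := x₂) hc₂
  -- The `P - 1` symbols received from the first block of `x₁` are the block of `x₂` without its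
  -- last bit, so both are deletions.
  have hhead : bits x₁ a P = bits x₂ a P := by
    refine hd.eq_of_delHit ?_ (h₁.head_modEq h₂)
    rw [Unhit, ho] at hu₂
    obtain ⟨l₁, l₂, hl₁, hl₁', hl₂⟩ := List.map_eq_append_iff.1 hu₂.symm
    obtain ⟨c, rfl⟩ : ∃ c, l₂ = [c] := by
      have := congrArg List.length hl₂
      simp only [List.length_map, List.length_cons, List.length_nil] at this
      exact List.length_eq_one_iff.1 this
    exact ⟨l₁, c, [], hl₁, by simp [hl₁']⟩
  rw [bits_blocks, bits_blocks, hhead, List.append_cancel_left_eq]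
  have h₁' := h₁.tail
  have h₂' := h₂.tail
  -- The symbol `o` was already consumed by the other reading; from an intact stretch of `x₁` this
  -- amounts to deleting the first bit.
  have del_of_cons : ∀ {m : ℕ} {y : List (Option Bool)}, 0 < m → m ≤ 2 * P →
      received e₁ x₁ (a + P) m = o :: y → DelHit (bits x₁ (a + P) m) y := by
    intro m y hm hm' hy
    have hu := unhit_received (x := x₁) (a := a + P) (m := m) (e := e₁)
      fun i hi hi' => hc₁ i hi (by omega)
    obtain ⟨k, rfl⟩ : ∃ k, m = k + 1 := ⟨m - 1, by omega⟩
    rw [Unhit, hy, bits_succ, List.map_cons, List.cons.injEq] at hu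
    exact ⟨[], _, _, by rw [bits_succ]; rfl, hu.2⟩
  cases r with
  | zero =>
    rw [zero_mul, zero_add] at hr ⊢
    have hD := del_of_cons (by omega) (by omega) hr
    have hDl := hD.length
    refine eq_of_hit (by simp only [bits_length]) (Or.inr (Or.inl hD)) ?_ (h₁'.last_modEq h₂')
    rcases hit_received he₂ x₂ (a := a + P) (m := P + s) (by omega) with hc | ⟨_, _, _, _, hh⟩
    · exact Or.inl (unhit_received hc)
    · exact Or.inr hh
  | succ r =>
    -- No error contradicts nonconstancy; a deletion realigns the readings after this block; an
    -- erasure or substitution carries the shift to the next block, where both patterns are clean.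
    rcases hit_received he₂ x₂ (a := a + P) (m := P) (by omega) with hc | ⟨q, hq, hq', hqe, hD | hS⟩
    · exact (h₁'.not_shift hP h₂' (fun i hi hi' => hc₁ i hi (by omega)) hc hr).elim
    · rw [received_blocks, received_blocks, ← List.cons_append] at hr
      have hDl := hD.length
      rw [bits_length] at hDl
      obtain ⟨hr1, hr2⟩ := List.append_inj hr (by
        rw [List.length_cons, hDl, received_length fun i hi hi' => hc₁ i hi (by omega)])
      rw [bits_blocks, bits_blocks, ih r (by omega) _ h₁'.tail h₂'.tail hr2,
        (del_of_cons hP (by omega) hr1).eq_of_delHit hD (h₁'.head_modEq h₂')]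
    · rw [received_blocks, received_blocks, ← List.cons_append] at hr
      have hSl := hS.length
      rw [bits_length] at hSl
      obtain ⟨o', -, hr2⟩ := append_eq_append_of_length_succ hr (by
        rw [List.length_cons, hSl, received_length fun i hi hi' => hc₁ i hi (by omega)])
      exact (h₁'.tail.not_shift' hP hs h₂'.tail (fun i hi hi' => hc₁ i (by omega) (by omega))
        (fun i hi hi' => he₂.eq_none hqe (by omega) (by omega) (by omega)) hr2).elim

/-- Strong induction is needed because a loss of synchronisation that is later repaired uses up two
blocks at once. -/
theorem IsBlockWord.bits_eq (hP : 0 < P) (hs : s < P) (he₁ : Far e₁ (3 * P))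
    (he₂ : Far e₂ (3 * P)) (r a : ℕ)
    (h₁ : IsBlockWord P s a₁ a₂ x₁ a r) (h₂ : IsBlockWord P s a₁ a₂ x₂ a r)
    (h : received e₁ x₁ a (r * P + (P + s)) = received e₂ x₂ a (r * P + (P + s))) :
    bits x₁ a (r * P + (P + s)) = bits x₂ a (r * P + (P + s)) := by
  induction r using Nat.strong_induction_on generalizing a with
  | _ r ih =>
  have hit : ∀ {e : ℕ → Option ErrorKind} (x : ℕ → Bool) {m : ℕ}, Far e (3 * P) → m ≤ 3 * P →
      Unhit (bits x a m) (received e x a m) ∨ DelHit (bits x a m) (received e x a m) ∨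
        SymHit (bits x a m) (received e x a m) := by
    intro e x m he hm
    rcases hit_received he x (a := a) hm with hc | ⟨_, _, _, _, hh⟩
    · exact Or.inl (unhit_received hc)
    · exact Or.inr hh
  cases r with
  | zero =>
    rw [zero_mul, zero_add] at h ⊢
    refine eq_of_hit (by simp only [bits_length]) (hit x₁ he₁ (by omega)) ?_ (h₁.last_modEq h₂)
    rw [h]
    exact hit x₂ he₂ (by omega)
  | succ r =>
    by_cases hl : (received e₁ x₁ a P).length = (received e₂ x₂ a P).length
    · rw [received_blocks, received_blocks] at h
      obtain ⟨hh, ht⟩ := List.append_inj h hl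
      rw [bits_blocks, bits_blocks, ih r (by omega) _ h₁.tail h₂.tail ht]
      congr 1
      refine eq_of_hit (by simp only [bits_length]) (hit x₁ he₁ (by omega)) ?_ (h₁.head_modEq h₂)
      rw [hh]
      exact hit x₂ he₂ (by omega)
    have length_of_not_del : ∀ {e : ℕ → Option ErrorKind} (x : ℕ → Bool), Far e (3 * P) →
        (received e x a P).length = P ∨ ∃ p, a ≤ p ∧ p < a + P ∧ e p ≠ none ∧
          DelHit (bits x a P) (received e x a P) := by
      intro e x he
      rcases hit_received he x (a := a) (m := P) (by omega) with
        hc | ⟨p, h1, h2, h3, hD | hS⟩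
      · exact Or.inl (received_length hc)
      · exact Or.inr ⟨p, h1, h2, h3, hD⟩
      · exact Or.inl (by rw [hS.length, bits_length])
    rcases length_of_not_del x₁ he₁ with hl₁ | ⟨p, hp, hp', hpe, hD₁⟩ <;>
      rcases length_of_not_del x₂ he₂ with hl₂ | ⟨q, hq, hq', hqe, hD₂⟩
    · omega
    · exact (h₂.eq_of_delHit hP hs he₂ he₁ (fun r' hr' a' k₂ k₁ k =>
        (ih r' (by omega) a' k₁ k₂ k.symm).symm) h₁ h.symm hq hq' hqe hD₂ hl₁).symm
    · exact h₁.eq_of_delHit hP hs he₁ he₂ (fun r' hr' => ih r' (by omega)) h₂ h hp hp' hpe hD₁ hl₂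
    · have := hD₁.length
      have := hD₂.length
      simp only [bits_length] at *
      omega

end

/-! ### Transfer to words and patterns of length `n`. -/

section

variable {n : ℕ}

/-- The bits of a word as a function of the place, `false` outside of the word. -/
def Word.extend (x : Word n) (i : ℕ) : Bool := if h : i < n then x ⟨i, h⟩ else false

/-- The errors of a pattern as a function of the place, `none` standing for no error. -/
def ErrorPattern.extend (g : ErrorPattern n) (i : ℕ) : Option ErrorKind :=
  if h : i < n then if g.1 ⟨i, h⟩ then some (g.2 ⟨i, h⟩) else none else none

theorem corrupt_eq_received (g : ErrorPattern n) (x : Word n) :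
    corrupt g x = received (ErrorPattern.extend g) (Word.extend x) 0 n := by
  rw [corrupt, received, ← List.range_eq_range', ← List.map_coe_finRange_eq_range,
    List.flatMap_map]
  refine List.flatMap_congr fun i _ => ?_
  cases h : g.1 i <;> simp [ErrorPattern.extend, Word.extend, corruptBit, h]

theorem far_extend {g : ErrorPattern n} {Q : ℕ} (hg : g ∈ farPatterns n Q) :
    Far (ErrorPattern.extend g) Q := by
  intro i j hij hi hj
  simp only [ErrorPattern.extend] at hi hj
  split_ifs at hi hj with h1 h2 h3 h4
  all_goals try exact absurd rfl hi
  all_goals try exact absurd rfl hj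
  have := hg ⟨i, h1⟩ ⟨j, h3⟩ (by simpa using hij.ne) h2 h4
  rw [abs_of_nonpos (by simp only; omega)] at this
  simp only at this
  omega

theorem bits_extend (x : Word n) (k m : ℕ) :
    bits (Word.extend x) k m = List.ofFn (subword x k m) := by
  refine List.ext_getElem (by simp [bits]) fun i h1 h2 => ?_
  simp [bits, Word.extend, subword]

theorem vtSum_ofFn {m : ℕ} (k : ℕ) (x : Word m) :
    vtSum k (List.ofFn x) = ∑ i : Fin m, ((i : ℕ) + k) * (x i).toNat := by
  induction m generalizing k with
  | zero => simp [vtSum]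
  | succ m ih =>
    rw [List.ofFn_succ, vtSum, ih, Fin.sum_univ_succ]
    simp [add_assoc, add_comm 1 k]

theorem mem_vtCode {a m : ℕ} {x : Word m} :
    x ∈ vtCode a m ↔ vtSum 1 (List.ofFn x) ≡ a [MOD 2 * m + 1] := by
  rw [vtSum_ofFn, vtCode, Finset.mem_filter]
  simp

theorem ofFn_eq_replicate_iff {m : ℕ} {x : Word m} {b : Bool} :
    List.ofFn x = List.replicate m b ↔ x = fun _ => b := by
  rw [← List.ofFn_const, List.ofFn_inj]

theorem isBlockWord_extend {P a₁ a₂ : ℕ} {x : Word n} (hx : x ∈ farCode n P a₁ a₂) :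
    IsBlockWord P (n % P) a₁ a₂ (Word.extend x) 0 (n / P - 1) := by
  rw [farCode, Finset.mem_filter] at hx
  refine ⟨fun i hi => ?_, fun i hi b => ?_, ?_⟩
  · rw [bits_extend, zero_add]
    exact mem_vtCode.1 (hx.2.1 i hi).1
  · rw [bits_extend, zero_add, ne_eq, ofFn_eq_replicate_iff]
    cases b
    · exact (hx.2.1 i hi).2.1
    · exact (hx.2.1 i hi).2.2
  · rw [bits_extend, zero_add]
    exact mem_vtCode.1 hx.2.2

theorem length_eq_blocks {P : ℕ} (hP : 0 < P) (hPn : P ≤ n) :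
    n = (n / P - 1) * P + (P + n % P) := by
  have h1 : 1 ≤ n / P := (Nat.one_le_div_iff hP).2 hPn
  have h2 := Nat.div_add_mod' n P
  obtain ⟨t, ht⟩ : ∃ t, n / P = t + 1 := ⟨n / P - 1, by omega⟩
  rw [ht, Nat.add_one_mul] at h2
  rw [ht, Nat.add_sub_cancel]
  omega

theorem corrects_farCode {P : ℕ} (hP : 0 < P) (hPn : P ≤ n) (a₁ a₂ : ℕ) :
    Corrects (farCode n P a₁ a₂) (farPatterns n (3 * P)) := by
  intro x₁ hx₁ x₂ hx₂ hne g₁ hg₁ g₂ hg₂ h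
  apply hne
  rw [corrupt_eq_received, corrupt_eq_received] at h
  have hlen := length_eq_blocks hP hPn
  have := (isBlockWord_extend hx₁).bits_eq hP (Nat.mod_lt n hP) (far_extend hg₁) (far_extend hg₂)
    _ _ (isBlockWord_extend hx₂) (by rw [← hlen]; exact h)
  rw [← hlen, bits_extend, bits_extend, List.ofFn_inj] at this
  funext i
  simpa [subword] using congrFun this i

end

/-! ### Size and redundancy of the code. -/

/-- The nonconstant words of `vtCode a m`. -/
def vtCodeNonconst (a m : ℕ) : Finset (Word m) :=
  (vtCode a m).filter fun x => x ≠ (fun _ => false) ∧ x ≠ fun _ => true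

theorem exists_card_le_vtCode_filter (m : ℕ) (S : Finset (Word m)) :
    ∃ a ≤ 2 * m, S.card ≤ (2 * m + 1) * (S.filter fun x => x ∈ vtCode a m).card := by
  have hmap : ∀ x ∈ S, (∑ i : Fin m, ((i : ℕ) + 1) * (x i).toNat) % (2 * m + 1) ∈
      Finset.range (2 * m + 1) := fun x _ => Finset.mem_range.2 (Nat.mod_lt _ (by omega))
  by_contra! hlt
  have h := Finset.card_eq_sum_card_fiberwise hmap
  have hS : ∀ a ∈ Finset.range (2 * m + 1),
      (2 * m + 1) * (S.filter fun x =>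
        (∑ i : Fin m, ((i : ℕ) + 1) * (x i).toNat) % (2 * m + 1) = a).card < S.card := by
    intro a ha
    rw [Finset.mem_range] at ha
    refine lt_of_eq_of_lt ?_ (hlt a (by omega))
    congr 2
    ext x
    simp [vtCode, Nat.ModEq, Nat.mod_eq_of_lt ha]
  have := Finset.sum_lt_sum_of_nonempty ⟨0, Finset.mem_range.2 (by omega)⟩ hS
  rw [← Finset.mul_sum, ← h, Finset.sum_const, Finset.card_range, smul_eq_mul] at this
  exact lt_irrefl _ this

theorem exists_card_vtCode (m : ℕ) :
    ∃ a ≤ 2 * m, 2 ^ m ≤ (2 * m + 1) * (vtCode a m).card := by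
  obtain ⟨a, ha, h⟩ := exists_card_le_vtCode_filter m Finset.univ
  refine ⟨a, ha, ?_⟩
  simpa [Word] using h

theorem exists_card_vtCodeNonconst (m : ℕ) :
    ∃ a ≤ 2 * m, 2 ^ m ≤ (2 * m + 1) * (vtCodeNonconst a m).card + 2 := by
  obtain ⟨a, ha, h⟩ := exists_card_le_vtCode_filter m
    (Finset.univ \ {fun _ => false, fun _ => true})
  refine ⟨a, ha, ?_⟩
  have h1 : 2 ^ m ≤ (Finset.univ \ {fun _ => false, fun _ => true} : Finset (Word m)).card + 2 := by
    have h2 := Finset.le_card_sdiff ({fun _ => false, fun _ => true} : Finset (Word m)) Finset.univ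
    have h3 := Finset.card_le_two (a := (fun _ => false : Word m)) (b := fun _ => true)
    have h4 : (Finset.univ : Finset (Word m)).card = 2 ^ m := by simp [Word]
    omega
  refine h1.trans (Nat.add_le_add_right (h.trans (le_of_eq ?_)) 2)
  congr 2
  ext x
  simp [vtCodeNonconst, and_comm]

/-- Cutting into blocks maps the code onto the product of the block codes, since any admissible
blocks can be concatenated. -/
theorem card_farCode {n P : ℕ} (hP : 0 < P) (hPn : P ≤ n) (a₁ a₂ : ℕ) :
    (vtCodeNonconst a₁ P).card ^ (n / P - 1) * (vtCode a₂ (P + n % P)).card ≤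
      (farCode n P a₁ a₂).card := by
  have hlen := length_eq_blocks hP hPn
  set t := n / P - 1 with ht
  set M := P + n % P with hM
  have h1 : (Fintype.piFinset (fun _ : Fin t => vtCodeNonconst a₁ P) ×ˢ vtCode a₂ M).card =
      (vtCodeNonconst a₁ P).card ^ t * (vtCode a₂ M).card := by
    simp [Finset.card_product]
  rw [← h1]
  refine Finset.card_le_card_of_surjOn
    (fun x => (fun i : Fin t => subword x (i * P) P, subword x (t * P) M)) ?_
  rintro ⟨f, z⟩ hfz
  simp only [Finset.coe_product, Set.mem_prod, Finset.mem_coe, Fintype.mem_piFinset] at hfz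
  obtain ⟨hf, hz⟩ := hfz
  let x : Word n := fun i =>
    if h : (i : ℕ) < t * P then
      f ⟨i / P, (Nat.div_lt_iff_lt_mul hP).2 h⟩ ⟨i % P, Nat.mod_lt _ hP⟩
    else z ⟨i - t * P, by omega⟩
  have hx₁ : ∀ i : Fin t, subword x (i * P) P = f i := by
    intro i
    funext j
    have hb := Nat.mul_le_mul_right P (Nat.succ_le_of_lt i.2)
    rw [Nat.succ_mul] at hb
    have hlt : (i : ℕ) * P + j < t * P := by omega
    have hn : (i : ℕ) * P + j < n := by omega
    have hd : ((i : ℕ) * P + j) / P = i := by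
      rw [mul_comm, Nat.mul_add_div hP, Nat.div_eq_of_lt j.2, add_zero]
    have hm : ((i : ℕ) * P + j) % P = j := by
      rw [Nat.mul_add_mod', Nat.mod_eq_of_lt j.2]
    simp only [subword, x, hn, hlt, dif_pos, hd, hm]
  have hx₂ : subword x (t * P) M = z := by
    funext j
    have hn : t * P + (j : ℕ) < n := by omega
    have hlt : ¬ t * P + (j : ℕ) < t * P := by omega
    simp only [subword, x, hn, dif_pos, hlt, dif_neg, not_false_iff, Nat.add_sub_cancel_left]
  refine ⟨x, ?_, ?_⟩
  · rw [Finset.mem_coe, farCode, Finset.mem_filter]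
    refine ⟨Finset.mem_univ _, fun i hi => ?_, ?_⟩
    · rw [hx₁ ⟨i, hi⟩]
      have := hf ⟨i, hi⟩
      rwa [vtCodeNonconst, Finset.mem_filter] at this
    · rw [← ht, ← hM, hx₂]
      exact hz
  · simp only [hx₁, hx₂]

theorem redundancy_le_of_card {n P A₁ A₂ : ℕ} (hP : 2 ≤ P) (hPn : P ≤ n) {C : Finset (Word n)}
    (h₁ : 2 ^ P ≤ (2 * P + 1) * A₁ + 2)
    (h₂ : 2 ^ (P + n % P) ≤ (2 * (P + n % P) + 1) * A₂)
    (hC : A₁ ^ (n / P - 1) * A₂ ≤ C.card) (hδ : delta P < 1) :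
    redundancy C ≤ ((n : ℝ) / P - 1) * Real.logb 2 ((2 * P + 1) / (1 - delta P)) +
      Real.logb 2 P + 2 := by
  have hlen := length_eq_blocks (by omega) hPn
  have hmod := Nat.mod_lt n (by omega : 0 < P)
  have hdiv : ((n / P : ℕ) : ℝ) ≤ (n : ℝ) / P := Nat.cast_div_le
  have hdiv1 : 1 ≤ n / P := (Nat.one_le_div_iff (by omega)).2 hPn
  have hP' : (2 : ℝ) ≤ P := by exact_mod_cast hP
  have ht : ((n / P - 1 : ℕ) : ℝ) ≤ (n : ℝ) / P - 1 := by
    rw [Nat.cast_sub hdiv1, Nat.cast_one]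
    linarith
  set t := n / P - 1
  set M := P + n % P
  have hδ0 : 0 ≤ delta P := by
    rw [delta]
    positivity
  -- Absorbs the two constant words: `2 ^ P - 2 ≥ 2 ^ P * (1 - delta P)`.
  have hδ2 : 2 ≤ delta P * 2 ^ P := by
    obtain ⟨k, rfl⟩ : ∃ k, P = k + 1 := ⟨P - 1, by omega⟩
    have : delta (k + 1) * 2 ^ (k + 1) = 2 * (2 * ((k + 1 : ℕ) : ℝ) + 1) := by
      rw [delta, Nat.add_sub_cancel, pow_succ]
      field_simp
    rw [this]
    linarith
  set q : ℝ := (2 * P + 1) / (1 - delta P) with hq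
  have hδ1 : 0 < 1 - delta P := by linarith
  have hq1 : 1 ≤ q := by
    rw [hq, le_div_iff₀ hδ1]
    linarith
  have hA₁ : (2 : ℝ) ^ P / q ≤ A₁ := by
    have h : (2 : ℝ) ^ P ≤ (2 * P + 1) * A₁ + 2 := by exact_mod_cast h₁
    rw [hq, div_div_eq_mul_div, div_le_iff₀ (by linarith)]
    linarith
  -- `M ≤ 2 * P - 1` gives `2 * M + 1 ≤ 4 * P`, the source of the term `log P + 2`.
  have hA₂ : (2 : ℝ) ^ M / (4 * P) ≤ A₂ := by
    have h : 2 ^ M ≤ 4 * P * A₂ := h₂.trans (Nat.mul_le_mul_right _ (by omega))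
    have h : (2 : ℝ) ^ M ≤ 4 * P * A₂ := by exact_mod_cast h
    rw [div_le_iff₀ (by linarith)]
    linarith
  have hcard : ((2 : ℝ) ^ P / q) ^ t * (2 ^ M / (4 * P)) ≤ C.card := by
    have h : (A₁ : ℝ) ^ t * A₂ ≤ C.card := by exact_mod_cast hC
    refine le_trans ?_ h
    gcongr
  clear_value q
  have hlog := Real.logb_le_logb_of_le one_lt_two (by positivity) hcard
  have h4 : Real.logb 2 (4 * P) = 2 + Real.logb 2 P := by
    rw [Real.logb_mul (by norm_num) (by positivity), show (4 : ℝ) = 2 ^ 2 by norm_num,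
      Real.logb_pow, Real.logb_self_eq_one one_lt_two]
    norm_num
  rw [Real.logb_mul (by positivity) (by positivity), Real.logb_pow,
    Real.logb_div (by positivity) (by positivity), Real.logb_div (by positivity) (by positivity),
    Real.logb_pow, Real.logb_pow, Real.logb_self_eq_one one_lt_two, h4] at hlog
  have hn : (n : ℝ) = t * P + M := by exact_mod_cast hlen
  have hmono := mul_le_mul_of_nonneg_right ht (Real.logb_nonneg one_lt_two hq1)
  rw [redundancy]
  linarith

theorem exists_farCode (n P : ℕ) (hP : 2 ≤ P) (hPn : P ≤ n) :
    ∃ a₁ a₂ : ℕ, a₁ ≤ 2 * P ∧ a₂ ≤ 2 * (P + n % P) ∧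
      (farCode n P a₁ a₂).Nonempty ∧
      Corrects (farCode n P a₁ a₂) (farPatterns n (3 * P)) ∧
      (delta P < 1 →
        redundancy (farCode n P a₁ a₂) ≤
          ((n : ℝ) / P - 1) * Real.logb 2 ((2 * P + 1) / (1 - delta P)) +
            Real.logb 2 P + 2) := by
  obtain ⟨a₁, ha₁, h₁⟩ := exists_card_vtCodeNonconst P
  obtain ⟨a₂, ha₂, h₂⟩ := exists_card_vtCode (P + n % P)
  have hC := card_farCode (by omega) hPn a₁ a₂
  refine ⟨a₁, a₂, ha₁, ha₂, ?_, corrects_farCode (by omega) hPn a₁ a₂,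
    redundancy_le_of_card hP hPn h₁ h₂ hC⟩
  rw [← Finset.card_pos]
  refine lt_of_lt_of_le (Nat.mul_pos (pow_pos ?_ _) ?_) hC
  · rw [Nat.pos_iff_ne_zero]
    intro h0
    rw [h0] at h₁
    have := Nat.pow_le_pow_right two_pos hP
    omega
  · rw [Nat.pos_iff_ne_zero]
    intro h0
    rw [h0] at h₂
    have := Nat.two_pow_pos (P + n % P)
    omega

theorem theorem3 :
    (∀ n P : ℕ, 2 ≤ P → P ≤ n →
      ∃ a₁ a₂ : ℕ, a₁ ≤ 2 * P ∧ a₂ ≤ 2 * (P + n % P) ∧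
        (farCode n P a₁ a₂).Nonempty ∧
        Corrects (farCode n P a₁ a₂) (farPatterns n (3 * P)) ∧
        (delta P < 1 →
          redundancy (farCode n P a₁ a₂) ≤
            ((n : ℝ) / P - 1) * Real.logb 2 ((2 * P + 1) / (1 - delta P)) +
              Real.logb 2 P + 2)) ∧
    (∀ P : ℕ, 2 ≤ P → ∃ N : ℕ, ∀ n ≥ N, ∀ A : Finset (Word n),
      Corrects A (farPatterns n (3 * P)) →
        (n : ℝ) / (64 * (3 * P + 6)) - 3 ≤ redundancy A) ∧
    (∀ P : ℕ → ℕ,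
      Tendsto (fun n : ℕ => (P n : ℝ) / Real.logb 2 n) atTop atTop →
      Tendsto (fun n : ℕ => (P n : ℝ) / Real.sqrt (n * Real.logb 2 n)) atTop (𝓝 0) →
      ∃ N : ℕ, ∀ n ≥ N, ∀ B : Finset (Word n),
        Corrects B (farPatterns n (3 * P n)) →
          ((n : ℝ) / (6 * P n) - 1) * Real.logb 2 (3 * P n / 64) - 2 ≤ redundancy B) :=
  ⟨exists_farCode, redundancy_lower_bound_const, fun P hP _ => redundancy_lower_bound_growing P hP⟩
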